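/- Let $K$ be a number field, let $\overline{\mathbb{Q}}$ be an algebraic closure of $\mathbb{Q}$ containing $K$, and let $F$ be a field with $K\subseteq F\subseteq\overline{\mathbb{Q}}$. Let $\mathcal{G}$ be either the multiplicative group $\mathbb{G}_m$ or an elliptic curve defined over $K$. The canonical height on $\mathcal{G}(\overline{\mathbb{Q}})$ is the absolute logarithmic Weil height $h$ if $\mathcal{G}=\mathbb{G}_m$, and the Néron–Tate height $\widehat{h}(P)=\lim_{n\to\infty}4^{-n}h(x(2^nP))$ if $\mathcal{G}$ is an elliptic curve, where $x$ is the $x$-coordinate of a Weierstrass model over $K$ and $h(x(O))=0$ by convention. Suppose that $F$ has the Bogomolov property with respect to $\mathcal{G}$, that is, there exists $\epsilon>0$ such that every non-torsion point of $\mathcal{G}(F)$ has canonical height at least $\epsilon$. Then the quotient $\mathcal{G}(F)/\mathcal{G}(F)_{\mathrm{tors}}$ of $\mathcal{G}(F)$ by its torsion subgroup is a free abelian group. -/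

import Mathlib

noncomputable section

/-- The naive (absolute, logarithmic) height `h(x(P))` of a point `P` on a Weierstrass curve over a
field of algebraic numbers; the point at infinity has height `0`. -/
def naiveHeight {L : Type*} [Field L] [CharZero L] {W : WeierstrassCurve L} :
    W.toAffine.Point → ℝ
  | .zero => 0
  | .some x _ _ => NumberField.absLogHeight₁ x

/-- The Néron–Tate height `lim 4⁻ⁿ h(x(2ⁿ P))`, normalized with respect to the divisor `2(O)`
(so it is the limit itself, not one half of it). -/
def neronTateHeight {L : Type*} [Field L] [CharZero L] [DecidableEq L] {W : WeierstrassCurve L}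
    (P : W.toAffine.Point) : ℝ :=
  Filter.limUnder Filter.atTop fun n : ℕ ↦ naiveHeight ((2 ^ n : ℕ) • P) / 4 ^ n

/-- The Bogomolov property of a field `F` of algebraic numbers with respect to `𝔾ₘ`: the absolute
logarithmic Weil height of the elements of `Fˣ` that are not roots of unity is bounded below by a
positive constant. -/
def BogomolovGm {K Qbar : Type*} [Field K] [Field Qbar] [CharZero Qbar] [Algebra K Qbar]
    (F : IntermediateField K Qbar) : Prop :=
  ∃ ε : ℝ, 0 < ε ∧ ∀ u : Fˣ, u ∉ CommGroup.torsion Fˣ →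
    ε ≤ NumberField.absLogHeight₁ ((u : F) : Qbar)

/-- The Bogomolov property of a field `F` of algebraic numbers with respect to an elliptic curve
`E` over a subfield `K` of `F`: the Néron–Tate height of the non-torsion points of `E(F)`, regarded
as points over the algebraic closure, is bounded below by a positive constant. -/
def BogomolovElliptic {K Qbar : Type*} [Field K] [Field Qbar] [CharZero Qbar] [DecidableEq Qbar]
    [Algebra K Qbar] (E : WeierstrassCurve K) (F : IntermediateField K Qbar) : Prop :=
  ∃ ε : ℝ, 0 < ε ∧ ∀ P : (E.baseChange F).toAffine.Point,
    P ∉ AddCommGroup.torsion (E.baseChange F).toAffine.Point →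
      ε ≤ neronTateHeight (WeierstrassCurve.Affine.Point.map (W' := E) F.val P)

end

/-!
Let `N` be a nonnegative function on an abelian group that is homogeneous of positive degree and
subadditive up to a constant. If `N` is bounded below by `ε > 0` off the torsion subgroup, it
descends to the quotient `A` by torsion. On the pure subgroup of `A` generated by finitely many
independent elements, clearing denominators bounds `N` by a power of the sup norm of the rational
coordinates, so this subgroup embeds discretely in some `ℝⁿ` and is finitely generated. For
countable `A` this is Pontryagin's criterion for freeness: the successive quotients in an increasing
exhaustion by such subgroups are finitely generated and torsion-free, so the exhaustion splits.

The canonical heights are of this kind. The heights of a tuple over two number fields `K ⊆ L` differ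
by the exponent `[L : K]`, so the absolute Weil height can be computed over any number field and is
homogeneous of degree `1`. On an elliptic curve, the pair `x(P + Q), x(P - Q)` is the image of
`x(P), x(Q)` under a quadratic morphism of `ℙ²`, viewed as the symmetric square of `ℙ¹`. Hence the
naive height satisfies the parallelogram law up to a bounded error over each number field; the
error disappears in Tate's limit, so the Néron–Tate height is homogeneous of degree `2`.
-/

section FreeModules

variable {R A : Type*} [CommRing R] [AddCommGroup A] [Module R A]

theorem exists_free_isCompl [IsDomain R] [IsPrincipalIdealRing R] [Module.Finite R A]
    (M : Submodule R A) [Module.IsTorsionFree R (A ⧸ M)] :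
    ∃ C : Submodule R A, Module.Free R C ∧ IsCompl M C := by
  obtain ⟨s, hs⟩ := M.mkQ.exists_rightInverse_of_surjective M.range_mkQ
  have hs_apply (q : A ⧸ M) : M.mkQ (s q) = q := LinearMap.congr_fun hs q
  refine ⟨LinearMap.range s, Module.Free.of_equiv (LinearEquiv.ofInjective s
    (Function.LeftInverse.injective hs_apply)), ?_, ?_⟩
  · rw [Submodule.disjoint_def]
    rintro _ hx ⟨q, rfl⟩
    rw [← hs_apply q, Submodule.mkQ_apply, (Submodule.Quotient.mk_eq_zero M).mpr hx, map_zero]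
  · rw [codisjoint_iff_le_sup]
    intro x _
    have hx : x - s (M.mkQ x) ∈ M := by
      rw [← Submodule.Quotient.mk_eq_zero, ← Submodule.mkQ_apply, map_sub, hs_apply, sub_self]
    exact sub_add_cancel x (s (M.mkQ x)) ▸ Submodule.add_mem_sup hx ⟨_, rfl⟩

theorem exists_free_disjoint_sup_eq [IsDomain R] [IsPrincipalIdealRing R] {M N : Submodule R A}
    (hMN : M ≤ N) (hN : N.FG) (hM : ∀ (r : R) (x : A), r ≠ 0 → r • x ∈ M → x ∈ M) :
    ∃ C : Submodule R A, Module.Free R C ∧ Disjoint M C ∧ M ⊔ C = N := by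
  have : Module.Finite R N := Module.Finite.iff_fg.mpr hN
  have : Module.IsTorsionFree R (N ⧸ M.comap N.subtype) := by
    refine .of_smul_eq_zero fun r q hq ↦ or_iff_not_imp_left.mpr fun hr ↦ ?_
    induction q using Submodule.Quotient.induction_on with | _ x
    rw [← Submodule.Quotient.mk_smul, Submodule.Quotient.mk_eq_zero] at hq
    exact (Submodule.Quotient.mk_eq_zero _).mpr (hM r x hr hq)
  obtain ⟨C, hC, hMC⟩ := exists_free_isCompl (M.comap N.subtype)
  have hM_map : (M.comap N.subtype).map N.subtype = M := by
    rw [Submodule.map_comap_subtype, inf_eq_right.mpr hMN]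
  refine ⟨C.map N.subtype, Module.Free.of_equiv (N.equivSubtypeMap C), ?_, ?_⟩
  · exact hM_map ▸ Submodule.disjoint_map N.injective_subtype hMC.disjoint
  · rw [← hM_map, ← Submodule.map_sup, hMC.sup_eq_top, Submodule.map_subtype_top]

theorem iSupIndep_of_disjoint_biSup_lt {α : Type*} [CompleteLattice α] [IsModularLattice α]
    [IsCompactlyGenerated α] {C : ℕ → α} (hC : ∀ n, Disjoint (⨆ i < n, C i) (C n)) :
    iSupIndep C := by
  rw [iSupIndep_iff_supIndep]
  intro t
  induction t using Finset.induction_on_max with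
  | empty => exact Finset.supIndep_empty _
  | insert n t hlt ih =>
    exact ih.insert ((hC n).symm.mono_right
      (Finset.sup_le fun i hi ↦ le_iSup₂_of_le i (hlt i hi) le_rfl))

theorem free_of_filtration {G C : ℕ → Submodule R A} (hG_zero : G 0 = ⊥)
    (hG_top : ∀ x, ∃ n, x ∈ G n) (hdisj : ∀ n, Disjoint (G n) (C n))
    (hsup : ∀ n, G n ⊔ C n = G (n + 1)) [∀ n, Module.Free R (C n)] : Module.Free R A := by
  have hG (n : ℕ) : G n = ⨆ i < n, C i := by
    induction n with
    | zero => simp only [hG_zero, not_lt_zero, iSup_false, iSup_bot]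
    | succ n ih => rw [← hsup, ih, Nat.iSup_lt_succ]
  have hC_indep : iSupIndep C := iSupIndep_of_disjoint_biSup_lt fun n ↦ hG n ▸ hdisj n
  have hC_top : iSup C = ⊤ := by
    refine eq_top_iff.mpr fun x _ ↦ ?_
    obtain ⟨n, hx⟩ := hG_top x
    exact (iSup₂_le fun i _ ↦ le_iSup C i : ⨆ i < n, C i ≤ iSup C) (hG n ▸ hx)
  exact Module.Free.of_equiv (LinearEquiv.ofBijective (DirectSum.coeLinearMap C)
    (DirectSum.isInternal_submodule_of_iSupIndep_of_iSup_eq_top hC_indep hC_top))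

end FreeModules

section PureHull

variable {A : Type*} [AddCommGroup A]

/-- The pure (or isolated) subgroup generated by `s`, that is, the elements with a nonzero multiple
in the subgroup generated by `s`. It is encoded as the preimage of the `ℚ`-span of `s` in `ℚ ⊗ A`,
which makes rational coordinates available. -/
def pureHull (s : Set A) : Submodule ℤ A :=
  ((Submodule.span ℚ (TensorProduct.mk ℤ ℚ A 1 '' s)).restrictScalars ℤ).comap
    (TensorProduct.mk ℤ ℚ A 1)

theorem mem_pureHull {s : Set A} {x : A} :
    x ∈ pureHull s ↔
      TensorProduct.mk ℤ ℚ A 1 x ∈ Submodule.span ℚ (TensorProduct.mk ℤ ℚ A 1 '' s) :=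
  Iff.rfl

theorem pureHull_mono {s t : Set A} (h : s ⊆ t) : pureHull s ≤ pureHull t :=
  fun _ hx ↦ Submodule.span_mono (Set.image_mono h) hx

theorem subset_pureHull (s : Set A) : s ⊆ pureHull s :=
  fun _ hx ↦ Submodule.subset_span (Set.mem_image_of_mem _ hx)

theorem mem_pureHull_of_smul_mem {s : Set A} {n : ℤ} {x : A} (hn : n ≠ 0)
    (hx : n • x ∈ pureHull s) : x ∈ pureHull s := by
  rw [mem_pureHull, map_smul, ← Int.cast_smul_eq_zsmul ℚ] at hx
  exact (Submodule.smul_mem_iff (Submodule.span ℚ _) (Int.cast_ne_zero.mpr hn)).mp hx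

theorem rat_tensor_mk_injective [Module.IsTorsionFree ℤ A] :
    Function.Injective (TensorProduct.mk ℤ ℚ A 1) := by
  intro x y hxy
  obtain ⟨n, hn⟩ := (IsLocalizedModule.eq_iff_exists (nonZeroDivisors ℤ)
    (TensorProduct.mk ℤ ℚ A 1)).mp hxy
  exact smul_right_injective A (nonZeroDivisors.coe_ne_zero n) hn

theorem pureHull_empty [Module.IsTorsionFree ℤ A] : pureHull (∅ : Set A) = ⊥ := by
  refine eq_bot_iff.mpr fun x hx ↦ ?_
  rw [mem_pureHull, Set.image_empty, Submodule.span_empty, Submodule.mem_bot] at hx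
  exact rat_tensor_mk_injective (hx.trans (map_zero _).symm)

/-- **Pontryagin's criterion**. -/
theorem free_of_countable_of_fg_pureHull [Countable A] [Module.IsTorsionFree ℤ A]
    (hfg : ∀ s : Set A, s.Finite → (pureHull s).FG) : Module.Free ℤ A := by
  obtain ⟨f, hf⟩ := exists_surjective_nat A
  let G (n : ℕ) : Submodule ℤ A := pureHull (f '' Set.Iio n)
  have hG_succ (n : ℕ) : G n ≤ G (n + 1) :=
    pureHull_mono (Set.image_mono (Set.Iio_subset_Iio n.le_succ))
  have hC (n : ℕ) : ∃ C : Submodule ℤ A,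
      Module.Free ℤ C ∧ Disjoint (G n) C ∧ G n ⊔ C = G (n + 1) :=
    exists_free_disjoint_sup_eq (hG_succ n) (hfg _ ((Set.finite_Iio _).image f))
      fun _ _ ↦ mem_pureHull_of_smul_mem
  choose C hC_free hC_disj hC_sup using hC
  refine free_of_filtration (G := G) (C := C) ?_ (fun x ↦ ?_) hC_disj hC_sup
  · simp only [G, ← bot_eq_zero, Set.Iio_bot, Set.image_empty, pureHull_empty]
  · obtain ⟨n, rfl⟩ := hf x
    exact ⟨n + 1, subset_pureHull _ ⟨n, n.lt_succ_self, rfl⟩⟩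

end PureHull

/-- A function on an abelian group that behaves like a nonnegative homogeneous form of degree `k`,
subadditive only up to a constant factor. The Weil height has degree `1` on `𝔾ₘ`, the Néron–Tate
height degree `2` on an elliptic curve. -/
structure IsHomogeneousHeight {G : Type*} [AddCommGroup G] (N : G → ℝ) (k : ℕ) : Prop where
  degree_ne_zero : k ≠ 0
  nonneg : ∀ x, 0 ≤ N x
  exists_add_le : ∃ C : ℝ, ∀ x y, N (x + y) ≤ C * (N x + N y)
  apply_zsmul : ∀ (n : ℤ) (x : G), N (n • x) = |(n : ℝ)| ^ k * N x

namespace IsHomogeneousHeight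

variable {G : Type*} [AddCommGroup G] {N : G → ℝ} {k : ℕ}

theorem apply_zero (hN : IsHomogeneousHeight N k) : N 0 = 0 := by
  have h := hN.apply_zsmul 0 0
  rwa [zero_smul, Int.cast_zero, abs_zero, zero_pow hN.degree_ne_zero, zero_mul] at h

theorem comp_addMonoidHom (hN : IsHomogeneousHeight N k) {H : Type*} [AddCommGroup H]
    (f : H →+ G) : IsHomogeneousHeight (N ∘ f) k where
  degree_ne_zero := hN.degree_ne_zero
  nonneg _ := hN.nonneg _
  exists_add_le := hN.exists_add_le.imp fun C hC x y ↦ by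
    simpa only [Function.comp_apply, map_add] using hC (f x) (f y)
  apply_zsmul n x := by simp only [Function.comp_apply, map_zsmul, hN.apply_zsmul]

theorem exists_sum_le (hN : IsHomogeneousHeight N k) {ι : Type*} (t : Finset ι) :
    ∃ D : ℝ, 0 < D ∧ ∀ f : ι → G, N (∑ i ∈ t, f i) ≤ D * ∑ i ∈ t, N (f i) := by
  classical
  obtain ⟨C, hC⟩ := hN.exists_add_le
  induction t using Finset.induction_on with
  | empty => exact ⟨1, one_pos, fun f ↦ by simp only [Finset.sum_empty, hN.apply_zero, mul_zero,
      le_refl]⟩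
  | insert i t hi ih =>
    obtain ⟨D, -, hsum⟩ := ih
    refine ⟨max 1 C * max 1 D, by positivity, fun f ↦ ?_⟩
    rw [Finset.sum_insert hi, Finset.sum_insert hi]
    have hi_nonneg := hN.nonneg (f i)
    have ht_nonneg := hN.nonneg (∑ j ∈ t, f j)
    have hsum_nonneg : 0 ≤ ∑ j ∈ t, N (f j) := Finset.sum_nonneg fun j _ ↦ hN.nonneg _
    calc N (f i + ∑ j ∈ t, f j) ≤ C * (N (f i) + N (∑ j ∈ t, f j)) := hC _ _
      _ ≤ max 1 C * (1 * N (f i) + D * ∑ j ∈ t, N (f j)) := by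
        rw [one_mul]
        gcongr
        exacts [le_max_right _ _, hsum f]
      _ ≤ max 1 C * (max 1 D * N (f i) + max 1 D * ∑ j ∈ t, N (f j)) := by
        gcongr
        exacts [le_max_left _ _, le_max_right _ _]
      _ = max 1 C * max 1 D * (N (f i) + ∑ j ∈ t, N (f j)) := by ring

theorem isTorsionFree (hN : IsHomogeneousHeight N k) {ε : ℝ} (hε : 0 < ε)
    (hdisc : ∀ x, x ≠ 0 → ε ≤ N x) : Module.IsTorsionFree ℤ G := by
  refine .of_smul_eq_zero fun n x hnx ↦ or_iff_not_imp_right.mpr fun hx ↦ ?_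
  have h : |(n : ℝ)| ^ k * N x = 0 := by rw [← hN.apply_zsmul, hnx, hN.apply_zero]
  have hn : |(n : ℝ)| ^ k = 0 :=
    (mul_eq_zero.mp h).resolve_right (hε.trans_le (hdisc x hx)).ne'
  exact_mod_cast abs_eq_zero.mp (pow_eq_zero_iff hN.degree_ne_zero |>.mp hn)

theorem exists_le_mul_norm_pow [Module.IsTorsionFree ℤ G] (hN : IsHomogeneousHeight N k)
    {ι : Type*} [Fintype ι] (e : ι → G) :
    ∃ D : ℝ, 0 < D ∧ ∀ (x : G) (c : ι → ℚ),
      TensorProduct.mk ℤ ℚ G 1 x = ∑ i, c i • TensorProduct.mk ℤ ℚ G 1 (e i) →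
        N x ≤ D * ‖fun i ↦ (c i : ℝ)‖ ^ k := by
  obtain ⟨D, hD, hsum⟩ := hN.exists_sum_le (Finset.univ : Finset ι)
  have he_nonneg : 0 ≤ ∑ i, N (e i) := Finset.sum_nonneg fun i _ ↦ hN.nonneg _
  refine ⟨D * (1 + ∑ i, N (e i)), by positivity, fun x c hx ↦ ?_⟩
  obtain ⟨⟨n, hn⟩, hc⟩ := IsLocalization.exist_integer_multiples_of_finite (nonZeroDivisors ℤ) c
  choose a ha using hc
  replace ha (i) : (a i : ℚ) = n * c i := by simpa using ha i
  have hnx : n • x = ∑ i, a i • e i := by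
    apply rat_tensor_mk_injective
    simp only [map_zsmul, map_sum, hx, Finset.smul_sum, ← Int.cast_smul_eq_zsmul ℚ, smul_smul, ha]
  have ha_real (i) : |(a i : ℝ)| = |(n : ℝ)| * |(c i : ℝ)| := by
    rw [← abs_mul]
    exact_mod_cast congrArg (fun q : ℚ ↦ |(q : ℝ)|) (ha i)
  have hn_pos : 0 < |(n : ℝ)| ^ k :=
    pow_pos (abs_pos.mpr (Int.cast_ne_zero.mpr (nonZeroDivisors.ne_zero hn))) k
  refine le_of_mul_le_mul_left ?_ hn_pos
  calc |(n : ℝ)| ^ k * N x = N (∑ i, a i • e i) := by rw [← hN.apply_zsmul, hnx]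
    _ ≤ D * ∑ i, N (a i • e i) := hsum _
    _ = D * ∑ i, |(n : ℝ)| ^ k * |(c i : ℝ)| ^ k * N (e i) := by
      simp only [hN.apply_zsmul, ha_real, mul_pow]
    _ ≤ D * ∑ i, |(n : ℝ)| ^ k * ‖fun i ↦ (c i : ℝ)‖ ^ k * N (e i) := by
      gcongr with i
      · exact hN.nonneg _
      · exact norm_le_pi_norm (fun i ↦ (c i : ℝ)) i
    _ = |(n : ℝ)| ^ k * (D * (∑ i, N (e i)) * ‖fun i ↦ (c i : ℝ)‖ ^ k) := by
      rw [← Finset.mul_sum]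
      ring
    _ ≤ |(n : ℝ)| ^ k * (D * (1 + ∑ i, N (e i)) * ‖fun i ↦ (c i : ℝ)‖ ^ k) := by
      gcongr
      linarith

end IsHomogeneousHeight

theorem exists_coordinates_pureHull {A ι : Type*} [AddCommGroup A] [Fintype ι] {e : ι → A}
    (he : LinearIndependent ℚ fun i ↦ TensorProduct.mk ℤ ℚ A 1 (e i)) :
    ∃ φ : pureHull (Set.range e) →ₗ[ℤ] ι → ℚ, ∀ x : pureHull (Set.range e),
      TensorProduct.mk ℤ ℚ A 1 x = ∑ i, φ x i • TensorProduct.mk ℤ ℚ A 1 (e i) := by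
  let b := Module.Basis.span he
  have hmem (x : pureHull (Set.range e)) : TensorProduct.mk ℤ ℚ A 1 x ∈
      Submodule.span ℚ (Set.range fun i ↦ TensorProduct.mk ℤ ℚ A 1 (e i)) := by
    have := mem_pureHull.mp x.2
    rwa [← Set.range_comp] at this
  let ψ := (TensorProduct.mk ℤ ℚ A 1 ∘ₗ (pureHull (Set.range e)).subtype).codRestrict
    ((Submodule.span ℚ _).restrictScalars ℤ) hmem
  refine ⟨(b.equivFun.restrictScalars ℤ).toLinearMap ∘ₗ ψ, fun x ↦ ?_⟩
  have h := congrArg Subtype.val (b.sum_equivFun (ψ x))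
  rw [AddSubmonoidClass.coe_finsetSum] at h
  simp only [b, Submodule.coe_smul, Module.Basis.span_apply] at h
  exact h.symm

theorem discreteTopology_of_forall_le_mul_norm_pow {E : Type*} [NormedAddCommGroup E]
    {D ε : ℝ} {k : ℕ} (hD : 0 < D) (hε : 0 < ε) (hk : k ≠ 0)
    (hdisc : ∀ x : E, x ≠ 0 → ε ≤ D * ‖x‖ ^ k) : DiscreteTopology E := by
  refine .of_forall_le_norm (r := min 1 (ε / D)) (by positivity) fun x hx ↦ ?_
  by_contra! hlt
  obtain ⟨hlt_one, hlt_div⟩ := lt_min_iff.mp hlt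
  refine (hdisc x hx).not_gt ?_
  calc D * ‖x‖ ^ k ≤ D * ‖x‖ := by gcongr; exact pow_le_of_le_one (norm_nonneg x) hlt_one.le hk
    _ < ε := by rwa [lt_div_iff₀' hD] at hlt_div

namespace IsHomogeneousHeight

variable {G : Type*} [AddCommGroup G] {N : G → ℝ} {k : ℕ} {ε : ℝ}

theorem finite_pureHull_range (hN : IsHomogeneousHeight N k) (hε : 0 < ε)
    (hdisc : ∀ x, x ≠ 0 → ε ≤ N x) {ι : Type*} [Finite ι] {e : ι → G}
    (he : LinearIndependent ℚ fun i ↦ TensorProduct.mk ℤ ℚ G 1 (e i)) :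
    Module.Finite ℤ (pureHull (Set.range e)) := by
  have := hN.isTorsionFree hε hdisc
  have := Fintype.ofFinite ι
  obtain ⟨φ, hφ⟩ := exists_coordinates_pureHull he
  obtain ⟨D, hD, hbound⟩ := hN.exists_le_mul_norm_pow e
  let ψ : pureHull (Set.range e) →ₗ[ℤ] ι → ℝ :=
    ((Rat.castHom ℝ).toAddMonoidHom.compLeft ι).toIntLinearMap ∘ₗ φ
  have hbound_ψ (x : pureHull (Set.range e)) : N x ≤ D * ‖ψ x‖ ^ k := hbound x (φ x) (hφ x)
  have hψ_disc (x : pureHull (Set.range e)) (hx : x ≠ 0) : ε ≤ D * ‖ψ x‖ ^ k :=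
    (hdisc x (Submodule.coe_eq_zero.not.mpr hx)).trans (hbound_ψ x)
  have hψ_inj : Function.Injective ψ := by
    refine (injective_iff_map_eq_zero ψ).mpr fun x hx ↦ by_contra fun hne ↦ ?_
    have h := hψ_disc x hne
    rw [hx, norm_zero, zero_pow hN.degree_ne_zero, mul_zero] at h
    exact hε.not_ge h
  have : DiscreteTopology (LinearMap.range ψ) := by
    refine discreteTopology_of_forall_le_mul_norm_pow hD hε hN.degree_ne_zero ?_
    rintro ⟨_, x, rfl⟩ hx
    exact hψ_disc x fun h ↦ hx (Subtype.ext ((congrArg ψ h).trans ψ.map_zero))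
  exact Module.Finite.equiv (LinearEquiv.ofInjective ψ hψ_inj).symm

theorem fg_pureHull (hN : IsHomogeneousHeight N k) (hε : 0 < ε)
    (hdisc : ∀ x, x ≠ 0 → ε ≤ N x) {s : Set G} (hs : s.Finite) : (pureHull s).FG := by
  obtain ⟨b, hbs, -, hs_span, hb⟩ := exists_linearIndepOn_extension
    (linearIndepOn_empty ℚ (TensorProduct.mk ℤ ℚ G 1)) (Set.empty_subset s)
  have : Finite b := hs.subset hbs
  have hhull : pureHull s = pureHull (Set.range ((↑) : b → G)) := by
    rw [Subtype.range_coe]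
    exact le_antisymm (fun _ hx ↦ Submodule.span_le.mpr hs_span hx) (pureHull_mono hbs)
  rw [hhull, ← Module.Finite.iff_fg]
  exact hN.finite_pureHull_range hε hdisc hb

theorem free_of_countable (hN : IsHomogeneousHeight N k) (hε : 0 < ε)
    (hdisc : ∀ x, x ≠ 0 → ε ≤ N x) [Countable G] : Module.Free ℤ G :=
  have := hN.isTorsionFree hε hdisc
  free_of_countable_of_fg_pureHull fun _ ↦ hN.fg_pureHull hε hdisc

variable {A : Type*} [AddCommGroup A] {π : G →+ A}

theorem eq_of_isOfFinAddOrder_sub (hN : IsHomogeneousHeight N k) {x y : G}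
    (h : IsOfFinAddOrder (x - y)) : N x = N y := by
  obtain ⟨n, hn, hxy⟩ := h.exists_nsmul_eq_zero
  have hxy' : (n : ℤ) • x = (n : ℤ) • y := by
    rw [← sub_eq_zero, ← smul_sub, natCast_zsmul, hxy]
  have hn_pos : 0 < |((n : ℤ) : ℝ)| ^ k :=
    pow_pos (abs_pos.mpr (by exact_mod_cast hn.ne')) k
  refine mul_left_cancel₀ hn_pos.ne' ?_
  rw [← hN.apply_zsmul, hxy', hN.apply_zsmul]

theorem apply_surjInv (hN : IsHomogeneousHeight N k) (hπ : Function.Surjective π)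
    (hker : ∀ g, π g = 0 → IsOfFinAddOrder g) (g : G) :
    N (Function.surjInv hπ (π g)) = N g :=
  hN.eq_of_isOfFinAddOrder_sub (hker _ (by rw [map_sub, Function.surjInv_eq hπ, sub_self]))

theorem comp_surjInv (hN : IsHomogeneousHeight N k) (hπ : Function.Surjective π)
    (hker : ∀ g, π g = 0 → IsOfFinAddOrder g) :
    IsHomogeneousHeight (N ∘ Function.surjInv hπ) k where
  degree_ne_zero := hN.degree_ne_zero
  nonneg _ := hN.nonneg _
  exists_add_le := by
    obtain ⟨C, hC⟩ := hN.exists_add_le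
    refine ⟨C, hπ.forall₂.mpr fun g h ↦ ?_⟩
    simp only [Function.comp_apply, ← map_add, hN.apply_surjInv hπ hker]
    exact hC g h
  apply_zsmul n := hπ.forall.mpr fun g ↦ by
    simp only [Function.comp_apply, ← map_zsmul, hN.apply_surjInv hπ hker, hN.apply_zsmul]

theorem free_of_surjective [Countable G] (hN : IsHomogeneousHeight N k)
    (hπ : Function.Surjective π) (hker : ∀ g, π g = 0 → IsOfFinAddOrder g) (hε : 0 < ε)
    (hdisc : ∀ g, π g ≠ 0 → ε ≤ N g) : Module.Free ℤ A := by
  have : Countable A := hπ.countable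
  refine (hN.comp_surjInv hπ hker).free_of_countable hε (hπ.forall.mpr fun g hg ↦ ?_)
  rw [Function.comp_apply, hN.apply_surjInv hπ hker]
  exact hdisc g hg

theorem free_quotient_torsion [Countable G] (hN : IsHomogeneousHeight N k) (hε : 0 < ε)
    (hdisc : ∀ g ∉ AddCommGroup.torsion G, ε ≤ N g) :
    Module.Free ℤ (G ⧸ AddCommGroup.torsion G) :=
  hN.free_of_surjective (π := QuotientAddGroup.mk' (AddCommGroup.torsion G))
    (QuotientAddGroup.mk'_surjective _) (fun _ ↦ (QuotientAddGroup.eq_zero_iff _).mp) hε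
    fun g hg ↦ hdisc g ((QuotientAddGroup.eq_zero_iff g).not.mp hg)

end IsHomogeneousHeight

theorem IsHomogeneousHeight.free_additive_quotient_torsion {G : Type*} [CommGroup G] [Countable G]
    {N : Additive G → ℝ} {k : ℕ} (hN : IsHomogeneousHeight N k) {ε : ℝ} (hε : 0 < ε)
    (hdisc : ∀ g ∉ CommGroup.torsion G, ε ≤ N (.ofMul g)) :
    Module.Free ℤ (Additive (G ⧸ CommGroup.torsion G)) :=
  have : Countable (Additive G) := ‹Countable G›
  hN.free_of_surjective (π := (QuotientGroup.mk' (CommGroup.torsion G)).toAdditive)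
    (QuotientGroup.mk'_surjective (CommGroup.torsion G))
    (fun g hg ↦ (isOfFinAddOrder_ofMul_iff (x := g.toMul)).mpr
      ((QuotientGroup.eq_one_iff g.toMul).mp hg)) hε
    fun g hg ↦ hdisc g.toMul ((QuotientGroup.eq_one_iff g.toMul).not.mp hg)

section NumberFieldHeights

open NumberField Height

variable {K L : Type*} [Field K] [NumberField K] [Field L] [NumberField L] [Algebra K L]

theorem prod_infinitePlace_pow_mult {M : Type*} [CommMonoid M] (f : InfinitePlace K → M) :
    ∏ v : InfinitePlace K, f v ^ v.mult = ∏ φ : K →+* ℂ, f (InfinitePlace.mk φ) := by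
  classical
  rw [← Finset.prod_fiberwise' Finset.univ InfinitePlace.mk f]
  simp only [Finset.prod_const, InfinitePlace.card_filter_mk_eq]

open Classical in
theorem card_embeddings_extending (φ : K →+* ℂ) :
    (Finset.univ.filter fun ψ : L →+* ℂ ↦ ψ.comp (algebraMap K L) = φ).card =
      Module.finrank K L := by
  let : Algebra K ℂ := φ.toAlgebra
  rw [← AlgHom.card K L ℂ, ← Fintype.card_subtype]
  exact Fintype.card_congr
    { toFun ψ := { ψ.1 with commutes' := fun r ↦ RingHom.congr_fun ψ.2 r }
      invFun σ := ⟨σ.toRingHom, σ.comp_algebraMap⟩ }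

theorem prod_embeddings_comp_algebraMap {M : Type*} [CommMonoid M] (f : (K →+* ℂ) → M) :
    ∏ ψ : L →+* ℂ, f (ψ.comp (algebraMap K L)) = (∏ φ : K →+* ℂ, f φ) ^ Module.finrank K L := by
  classical
  rw [← Finset.prod_fiberwise' Finset.univ (fun ψ : L →+* ℂ ↦ ψ.comp (algebraMap K L)) f,
    ← Finset.prod_pow]
  refine Finset.prod_congr rfl fun φ _ ↦ ?_
  rw [Finset.prod_const, ← card_embeddings_extending φ]

variable {ι : Type*} [Finite ι]

theorem finprod_finitePlace_iSup_algebraMap {x : ι → 𝓞 K} (hx : x ≠ 0) :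
    ∏ᶠ v : FinitePlace L, ⨆ i, v (algebraMap K L (x i)) =
      (∏ᶠ v : FinitePlace K, ⨆ i, v (x i : K)) ^ Module.finrank K L := by
  let y : ι → 𝓞 L := algebraMap (𝓞 K) (𝓞 L) ∘ x
  have hy : y ≠ 0 := fun h ↦ hx <|
    (FaithfulSMul.algebraMap_injective (𝓞 K) (𝓞 L)).comp_left (h.trans (by ext i; simp))
  have hspan : Ideal.span (Set.range y) =
      (Ideal.span (Set.range x)).map (algebraMap (𝓞 K) (𝓞 L)) := by
    rw [Ideal.map_span, Set.range_comp]
  have hnorm : (Ideal.span (Set.range y)).absNorm =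
      (Ideal.span (Set.range x)).absNorm ^ Module.finrank K L := by
    rw [hspan, Ideal.absNorm_algebraMap, IsFractionRing.finrank_eq (𝓞 K) K (𝓞 L) L]
  have hx_norm := absNorm_mul_finprod_finitePlace_eq_one hx
  have hy_norm := absNorm_mul_finprod_finitePlace_eq_one hy
  rw [hnorm, Nat.cast_pow] at hy_norm
  refine mul_left_cancel₀ (left_ne_zero_of_mul_eq_one hy_norm) (hy_norm.trans ?_)
  rw [← mul_pow, hx_norm, one_pow]

theorem mulHeight_algebraMap_of_integral {x : ι → 𝓞 K} (hx : x ≠ 0) :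
    mulHeight (fun i ↦ algebraMap K L (x i)) =
      mulHeight (fun i ↦ (x i : K)) ^ Module.finrank K L := by
  obtain ⟨i, hi⟩ := Function.ne_iff.mp hx
  have hi_K : (x i : K) ≠ 0 := RingOfIntegers.coe_ne_zero_iff.mpr hi
  have hx_K : (fun i ↦ (x i : K)) ≠ 0 := Function.ne_iff.mpr ⟨i, hi_K⟩
  have hx_L : (fun i ↦ algebraMap K L (x i)) ≠ 0 :=
    Function.ne_iff.mpr ⟨i, (map_ne_zero _).mpr hi_K⟩
  rw [NumberField.mulHeight_eq hx_K, NumberField.mulHeight_eq hx_L, mul_pow,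
    finprod_finitePlace_iSup_algebraMap hx,
    prod_infinitePlace_pow_mult fun v ↦ ⨆ i, v (x i : K),
    prod_infinitePlace_pow_mult fun v ↦ ⨆ i, v (algebraMap K L (x i)),
    ← prod_embeddings_comp_algebraMap (L := L)]
  rfl

theorem mulHeight_algebraMap (x : ι → K) :
    mulHeight (algebraMap K L ∘ x) = mulHeight x ^ Module.finrank K L := by
  rcases eq_or_ne x 0 with rfl | hx
  · rw [show algebraMap K L ∘ (0 : ι → K) = 0 from funext fun _ ↦ map_zero _, mulHeight_zero,
      mulHeight_zero, one_pow]
  obtain ⟨⟨b, hb⟩, hbx⟩ :=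
    IsLocalization.exist_integer_multiples_of_finite (nonZeroDivisors (𝓞 K)) x
  choose y hy using hbx
  have hb_K : (b : K) ≠ 0 := RingOfIntegers.coe_ne_zero_iff.mpr (nonZeroDivisors.ne_zero hb)
  have hyx : (fun i ↦ (y i : K)) = (b : K) • x := funext hy
  have hyx_L : (fun i ↦ algebraMap K L (y i)) = algebraMap K L b • (algebraMap K L ∘ x) :=
    funext fun i ↦ (congrArg (algebraMap K L) (hy i)).trans (map_mul _ _ _)
  have hy_ne : y ≠ 0 := by
    rintro rfl
    exact smul_ne_zero hb_K hx (hyx.symm.trans (funext fun _ ↦ map_zero _))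
  have h := mulHeight_algebraMap_of_integral (L := L) hy_ne
  rwa [hyx, hyx_L, mulHeight_smul_eq_mulHeight _ hb_K,
    mulHeight_smul_eq_mulHeight _ ((map_ne_zero _).mpr hb_K)] at h

theorem logHeight₁_algebraMap (x : K) :
    logHeight₁ (algebraMap K L x) = Module.finrank K L * logHeight₁ x := by
  have h : ![algebraMap K L x, 1] = algebraMap K L ∘ ![x, 1] := by
    ext i
    fin_cases i
    exacts [rfl, (map_one _).symm]
  rw [logHeight₁_eq_log_mulHeight₁, logHeight₁_eq_log_mulHeight₁, mulHeight₁_eq_mulHeight,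
    mulHeight₁_eq_mulHeight, h, mulHeight_algebraMap, Real.log_pow]

end NumberFieldHeights

section AbsoluteHeight

open NumberField Height IntermediateField

variable {Ω : Type*} [Field Ω] [CharZero Ω]

theorem numberField_adjoin_simple {x : Ω} (hx : IsIntegral ℚ x) : NumberField ℚ⟮x⟯ where
  to_finiteDimensional := adjoin.finiteDimensional hx

theorem absLogHeight₁_eq_logHeight₁_gen_div {x : Ω} (hx : IsIntegral ℚ x) [NumberField ℚ⟮x⟯] :
    absLogHeight₁ x = logHeight₁ (AdjoinSimple.gen ℚ x) / Module.finrank ℚ ℚ⟮x⟯ := by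
  rw [absLogHeight₁, absMulHeight₁, dif_pos hx, Real.log_rpow (mulHeight₁_pos _),
    ← logHeight₁_eq_log_mulHeight₁]
  field_simp

theorem absLogHeight₁_nonneg (x : Ω) : 0 ≤ absLogHeight₁ x := by
  by_cases hx : IsIntegral ℚ x
  · have := numberField_adjoin_simple hx
    rw [absLogHeight₁_eq_logHeight₁_gen_div hx]
    exact div_nonneg (zero_le_logHeight₁ _) (Nat.cast_nonneg _)
  · rw [absLogHeight₁, absMulHeight₁, dif_neg hx, Real.log_one]

theorem absLogHeight₁_algebraMap {K : Type*} [Field K] [NumberField K] [Algebra K Ω] (x : K) :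
    absLogHeight₁ (algebraMap K Ω x) = logHeight₁ x / Module.finrank ℚ K := by
  set z : Ω := algebraMap K Ω x
  have hz : IsIntegral ℚ z := (Algebra.IsIntegral.isIntegral (R := ℚ) x).algebraMap
  have := numberField_adjoin_simple hz
  let e := AlgEquiv.ofInjectiveField (IsScalarTower.toAlgHom ℚ K Ω)
  have hle : ℚ⟮z⟯ ≤ (IsScalarTower.toAlgHom ℚ K Ω).fieldRange :=
    adjoin_simple_le_iff.mpr ⟨x, rfl⟩
  let : Algebra ℚ⟮z⟯ K := (e.symm.toRingHom.comp (inclusion hle).toRingHom).toAlgebra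
  have hgen : algebraMap ℚ⟮z⟯ K (AdjoinSimple.gen ℚ z) = x := e.symm_apply_eq.mpr rfl
  have hrank := Module.finrank_mul_finrank ℚ ℚ⟮z⟯ K
  have : Module.Finite ℚ⟮z⟯ K := Module.Finite.of_restrictScalars_finite ℚ _ _
  have hrank_pos : (0 : ℝ) < Module.finrank ℚ⟮z⟯ K := Nat.cast_pos.mpr Module.finrank_pos
  have hheight := logHeight₁_algebraMap (L := K) (AdjoinSimple.gen ℚ z)
  rw [hgen] at hheight
  rw [absLogHeight₁_eq_logHeight₁_gen_div hz, hheight, ← hrank, Nat.cast_mul,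
    mul_comm (Module.finrank ℚ ℚ⟮z⟯ : ℝ), mul_div_mul_left _ _ hrank_pos.ne']

theorem absLogHeight₁_coe {L : IntermediateField ℚ Ω} [NumberField L] (x : L) :
    absLogHeight₁ (x : Ω) = logHeight₁ x / Module.finrank ℚ L :=
  absLogHeight₁_algebraMap x

variable [Algebra.IsAlgebraic ℚ Ω]

theorem exists_numberField_subset (s : Finset Ω) :
    ∃ L : IntermediateField ℚ Ω, NumberField L ∧ (s : Set Ω) ⊆ L :=
  have : FiniteDimensional ℚ (adjoin ℚ (s : Set Ω)) :=
    finiteDimensional_adjoin fun x _ ↦ Algebra.IsIntegral.isIntegral x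
  ⟨adjoin ℚ (s : Set Ω), ⟨⟩, subset_adjoin ℚ _⟩

theorem absLogHeight₁_mul_le (x y : Ω) :
    absLogHeight₁ (x * y) ≤ absLogHeight₁ x + absLogHeight₁ y := by
  classical
  obtain ⟨L, _, hL⟩ := exists_numberField_subset {x, y}
  lift x to L using hL (by simp)
  lift y to L using hL (by simp)
  rw [← IntermediateField.coe_mul, absLogHeight₁_coe, absLogHeight₁_coe, absLogHeight₁_coe,
    ← add_div]
  gcongr
  exact logHeight₁_mul_le x y

theorem absLogHeight₁_zpow (x : Ω) (n : ℤ) :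
    absLogHeight₁ (x ^ n) = |(n : ℝ)| * absLogHeight₁ x := by
  obtain ⟨L, _, hL⟩ := exists_numberField_subset {x}
  lift x to L using hL (by simp)
  have hcoe : (x : Ω) ^ n = (x ^ n : L) := (map_zpow₀ L.val x n).symm
  rw [hcoe, absLogHeight₁_coe, absLogHeight₁_coe, logHeight₁_zpow, Nat.cast_natAbs, Int.cast_abs,
    mul_div_assoc]

end AbsoluteHeight

section AddSubMap

open WeierstrassCurve WeierstrassCurve.Affine WeierstrassCurve.Affine.Point

theorem eval_addSubMap {R : Type*} [CommRing R] (W : WeierstrassCurve R) (s t u : R) :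
    (fun i ↦ (addSubMap W i).eval ![s, t, u]) =
      ![s ^ 2 - W.b₄ * s * u - W.b₆ * t * u - W.b₈ * u ^ 2,
        2 * t * s + W.b₂ * s * u + W.b₄ * t * u + W.b₆ * u ^ 2, t ^ 2 - 4 * s * u] := by
  ext i
  fin_cases i <;> simp [addSubMap]

theorem sub_negY_sq_of_equation {R : Type*} [CommRing R] {W : WeierstrassCurve R} {x y : R}
    (h : W.toAffine.Equation x y) :
    (y - W.toAffine.negY x y) ^ 2 = 4 * x ^ 3 + W.b₂ * x ^ 2 + 2 * W.b₄ * x + W.b₆ := by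
  rw [negY, b₂, b₄, b₆]
  linear_combination 4 * (equation_iff x y).mp h

variable {F : Type*} [Field F] [DecidableEq F] {W : WeierstrassCurve F}

theorem addX_slope_self_mul {x y : F} (h : W.toAffine.Equation x y)
    (hy : y ≠ W.toAffine.negY x y) :
    W.toAffine.addX x x (W.toAffine.slope x x y y) * (y - W.toAffine.negY x y) ^ 2 =
      x ^ 4 - W.b₄ * x ^ 2 - 2 * W.b₆ * x - W.b₈ := by
  have hd : y - W.toAffine.negY x y ≠ 0 := sub_ne_zero.mpr hy
  rw [slope_of_Y_ne rfl hy, addX]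
  field_simp
  rw [negY, b₄, b₆, b₈]
  linear_combination -(W.a₁ ^ 2 + 4 * W.a₂ + 8 * x) * (equation_iff x y).mp h

section DistinctX

variable {x₁ x₂ y₁ y₂ : F} (h₁ : W.toAffine.Equation x₁ y₁) (h₂ : W.toAffine.Equation x₂ y₂)
  (hx : x₁ ≠ x₂)
include h₁ h₂ hx

theorem addX_slope_add_addX_slope_negY :
    (W.toAffine.addX x₁ x₂ (W.toAffine.slope x₁ x₂ y₁ y₂) +
        W.toAffine.addX x₁ x₂ (W.toAffine.slope x₁ x₂ y₁ (W.toAffine.negY x₂ y₂))) *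
          (x₁ - x₂) ^ 2 =
      2 * (x₁ + x₂) * (x₁ * x₂) + W.b₂ * (x₁ * x₂) + W.b₄ * (x₁ + x₂) + W.b₆ := by
  have hd : x₁ - x₂ ≠ 0 := sub_ne_zero.mpr hx
  rw [slope_of_X_ne hx, slope_of_X_ne hx, addX, addX]
  field_simp
  rw [negY, b₂, b₄, b₆]
  linear_combination 2 * (equation_iff x₁ y₁).mp h₁ + 2 * (equation_iff x₂ y₂).mp h₂

theorem addX_slope_mul_addX_slope_negY :
    W.toAffine.addX x₁ x₂ (W.toAffine.slope x₁ x₂ y₁ y₂) *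
        W.toAffine.addX x₁ x₂ (W.toAffine.slope x₁ x₂ y₁ (W.toAffine.negY x₂ y₂)) *
          (x₁ - x₂) ^ 2 =
      (x₁ * x₂) ^ 2 - W.b₄ * (x₁ * x₂) - W.b₆ * (x₁ + x₂) - W.b₈ := by
  have hd : x₁ - x₂ ≠ 0 := sub_ne_zero.mpr hx
  have heq₁ := (equation_iff x₁ y₁).mp h₁
  have heq₂ := (equation_iff x₂ y₂).mp h₂
  -- The two equations of the curve determine `a₄` and `a₆`.
  have ha₆ : W.a₆ = y₁ ^ 2 + W.a₁ * x₁ * y₁ + W.a₃ * y₁ -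
      (x₁ ^ 3 + W.a₂ * x₁ ^ 2 + W.a₄ * x₁) := by
    linear_combination -heq₁
  have ha₄ : W.a₄ = (y₁ ^ 2 + W.a₁ * x₁ * y₁ + W.a₃ * y₁ - (x₁ ^ 3 + W.a₂ * x₁ ^ 2) -
      (y₂ ^ 2 + W.a₁ * x₂ * y₂ + W.a₃ * y₂ - (x₂ ^ 3 + W.a₂ * x₂ ^ 2))) / (x₁ - x₂) := by
    rw [eq_div_iff hd]
    linear_combination heq₂ - heq₁
  rw [slope_of_X_ne hx, slope_of_X_ne hx, addX, addX, negY, b₄, b₆, b₈, ha₆, ha₄]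
  field_simp
  ring

end DistinctX

variable [W.IsElliptic]

theorem exists_eval_addSubMap_sym2x_self (P : W.toAffine.Point) :
    ∃ c : F, c ≠ 0 ∧ (fun i ↦ (addSubMap W i).eval (P.sym2x P)) = c • (P + P).sym2x 0 := by
  have hne := addSubMap_ne_zero W (sym2x_ne_zero P P)
  rcases P with _ | ⟨x, y, h⟩
  · refine ⟨1, one_ne_zero, ?_⟩
    rw [← zero_def, add_zero, sym2x_zero_zero, eval_addSubMap, Matrix.smul_vec3]
    simp
  have hsq := sub_negY_sq_of_equation h.1
  rw [sym2x_some_some, eval_addSubMap] at hne ⊢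
  by_cases hy : y = W.toAffine.negY x y
  · rw [sub_eq_zero.mpr hy] at hsq
    rw [add_self_of_Y_eq hy, sym2x_zero_zero]
    set s := (x * x) ^ 2 - W.b₄ * (x * x) * 1 - W.b₆ * (x + x) * 1 - W.b₈ * 1 ^ 2
    have hvec : ![s, 2 * (x + x) * (x * x) + W.b₂ * (x * x) * 1 + W.b₄ * (x + x) * 1 +
        W.b₆ * 1 ^ 2, (x + x) ^ 2 - 4 * (x * x) * 1] = s • ![1, 0, 0] := by
      rw [Matrix.smul_vec3, smul_eq_mul, smul_zero]
      exact Matrix.vec3_eq (mul_one s).symm (by linear_combination -hsq) (by ring)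
    rw [hvec] at hne ⊢
    exact ⟨s, left_ne_zero_of_smul hne, rfl⟩
  · refine ⟨(y - W.toAffine.negY x y) ^ 2, pow_ne_zero _ (sub_ne_zero.mpr hy), ?_⟩
    rw [add_self_of_Y_ne hy, sym2x_some_zero, Matrix.smul_vec3]
    simp only [smul_eq_mul]
    exact Matrix.vec3_eq (by linear_combination -addX_slope_self_mul h.1 hy)
      (by linear_combination -hsq) (by ring)

theorem exists_eval_addSubMap_sym2x (P Q : W.toAffine.Point) :
    ∃ c : F, c ≠ 0 ∧ (fun i ↦ (addSubMap W i).eval (P.sym2x Q)) = c • (P + Q).sym2x (P - Q) := by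
  by_cases hPQ : P.xRep = Q.xRep
  · obtain rfl | rfl := eq_or_eq_neg_of_xRep_eq_xRep hPQ
    · rw [sub_self]
      exact exists_eval_addSubMap_sym2x_self P
    · rw [sym2x_neg_left, neg_add_cancel, ← neg_add', sym2x_neg_right, sym2x_comm 0]
      exact exists_eval_addSubMap_sym2x_self Q
  rcases P with _ | ⟨x₁, y₁, h₁⟩ <;> rcases Q with _ | ⟨x₂, y₂, h₂⟩
  · exact absurd rfl hPQ
  · refine ⟨1, one_ne_zero, ?_⟩
    rw [← zero_def, zero_add, zero_sub, one_smul, sym2x_neg_right, sym2x_zero_some,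
      sym2x_some_some, eval_addSubMap]
    exact Matrix.vec3_eq (by ring) (by ring) (by ring)
  · refine ⟨1, one_ne_zero, ?_⟩
    rw [← zero_def, add_zero, sub_zero, one_smul, sym2x_some_zero, sym2x_some_some, eval_addSubMap]
    exact Matrix.vec3_eq (by ring) (by ring) (by ring)
  · have hx : x₁ ≠ x₂ := fun h ↦ hPQ (by rw [xRep_some, xRep_some, h])
    refine ⟨(x₁ - x₂) ^ 2, pow_ne_zero _ (sub_ne_zero.mpr hx), ?_⟩
    rw [sub_eq_add_neg (some x₁ y₁ h₁), neg_some, add_of_X_ne hx, add_of_X_ne hx, sym2x_some_some,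
      sym2x_some_some, eval_addSubMap, Matrix.smul_vec3]
    simp only [smul_eq_mul]
    exact Matrix.vec3_eq (by linear_combination -addX_slope_mul_addX_slope_negY h₁.1 h₂.1 hx)
      (by linear_combination -addX_slope_add_addX_slope_negY h₁.1 h₂.1 hx) (by ring)

open Height in
variable (W) in
theorem exists_abs_logHeight_xRep_parallelogram_le [AdmissibleAbsValues F] :
    ∃ C : ℝ, ∀ P Q : W.toAffine.Point,
      |logHeight (P + Q).xRep + logHeight (P - Q).xRep -
        2 * (logHeight P.xRep + logHeight Q.xRep)| ≤ C := by
  obtain ⟨C₁, hC₁⟩ := abs_logHeight_addSubMap_sub_two_mul_logHeight_le W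
  obtain ⟨C₂, hC₂⟩ := abs_logHeight_sym2_sub_le F
  have hsym (P Q : W.toAffine.Point) :
      |logHeight (P.sym2x Q) - (logHeight P.xRep + logHeight Q.xRep)| ≤ C₂ := by
    have hvec (v : Fin 2 → F) : ![v 0, v 1] = v := List.ofFn_inj.mp rfl
    have h := hC₂ (a := P.xRep 0) (b := P.xRep 1) (c := Q.xRep 0) (d := Q.xRep 1)
    rw [hvec, hvec] at h
    exact h P.xRep_ne_zero Q.xRep_ne_zero
  refine ⟨C₁ + 3 * C₂, fun P Q ↦ ?_⟩
  obtain ⟨c, hc, hmap⟩ := exists_eval_addSubMap_sym2x P Q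
  have hdeg := hC₁ (P.sym2x Q)
  rw [hmap, logHeight_smul_eq_logHeight _ hc] at hdeg
  have hsym_source := abs_le.mp (hsym P Q)
  have hsym_target := abs_le.mp (hsym (P + Q) (P - Q))
  rw [abs_le] at hdeg ⊢
  constructor <;> linarith

end AddSubMap

section TateLimit

open Filter Topology

variable {A : Type*} [AddCommGroup A]

theorem apply_zsmul_of_parallelogram {f : A → ℝ}
    (hf : ∀ x y, f (x + y) + f (x - y) = 2 * (f x + f y)) (n : ℤ) (x : A) :
    f (n • x) = (n : ℝ) ^ 2 * f x := by
  have hzero : f 0 = 0 := by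
    have := hf 0 0
    rw [add_zero, sub_zero] at this
    linarith
  have hneg (y : A) : f (-y) = f y := by
    have := hf 0 y
    rw [zero_add, zero_sub, hzero] at this
    linarith
  have hnat (n : ℕ) : f (n • x) = (n : ℝ) ^ 2 * f x := by
    induction n using Nat.twoStepInduction with
    | zero => simp [hzero]
    | one => simp
    | more n ih₁ ih₂ =>
      have h := hf ((n + 1) • x) x
      rw [← succ_nsmul, succ_nsmul x n, add_sub_cancel_right, ← succ_nsmul x n, ih₁, ih₂] at h
      push_cast at h ⊢
      linarith
  obtain ⟨m, rfl | rfl⟩ := n.eq_nat_or_neg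
  · simpa using hnat m
  · simpa [hneg] using hnat m

theorem isHomogeneousHeight_of_parallelogram {f : A → ℝ} (hnonneg : ∀ x, 0 ≤ f x)
    (hf : ∀ x y, f (x + y) + f (x - y) = 2 * (f x + f y)) : IsHomogeneousHeight f 2 where
  degree_ne_zero := two_ne_zero
  nonneg := hnonneg
  exists_add_le := ⟨2, fun x y ↦ by linarith [hf x y, hnonneg (x - y)]⟩
  apply_zsmul n x := by rw [sq_abs, apply_zsmul_of_parallelogram hf]

/-- The canonical height that Tate's telescoping argument attaches to a function `h` which is
quadratic up to a bounded error; a junk value where the limit does not exist. -/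
noncomputable def tateLimit (h : A → ℝ) (x : A) : ℝ :=
  limUnder atTop fun n : ℕ ↦ h ((2 ^ n : ℕ) • x) / 4 ^ n

/-- `h` satisfies the parallelogram law up to a bounded error on subgroups containing any two given
elements. The bound may depend on the subgroup: for points over an infinite algebraic extension of
`ℚ` it is only available over each number field separately. -/
def LocallyApproxParallelogram (h : A → ℝ) : Prop :=
  ∀ x y : A, ∃ S : AddSubgroup A, x ∈ S ∧ y ∈ S ∧ ∃ C : ℝ, ∀ u ∈ S, ∀ v ∈ S,
    |h (u + v) + h (u - v) - 2 * (h u + h v)| ≤ C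

namespace LocallyApproxParallelogram

variable {h : A → ℝ} (hh : LocallyApproxParallelogram h)
include hh

theorem exists_abs_doubling_le (x : A) :
    ∃ C : ℝ, ∀ n : ℕ, |h ((2 ^ (n + 1) : ℕ) • x) - 4 * h ((2 ^ n : ℕ) • x)| ≤ C := by
  obtain ⟨S, hx, -, C, hC⟩ := hh x x
  refine ⟨C + |h 0|, fun n ↦ ?_⟩
  have hn := hC _ (S.nsmul_mem hx (2 ^ n)) _ (S.nsmul_mem hx (2 ^ n))
  rw [sub_self, ← two_nsmul, ← mul_nsmul', ← pow_succ', abs_le] at hn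
  have hzero := abs_le.mp (le_refl |h 0|)
  rw [abs_le]
  constructor <;> linarith

theorem tendsto_tateLimit (x : A) :
    Tendsto (fun n : ℕ ↦ h ((2 ^ n : ℕ) • x) / 4 ^ n) atTop (𝓝 (tateLimit h x)) := by
  obtain ⟨C, hC⟩ := hh.exists_abs_doubling_le x
  refine (cauchySeq_of_le_geometric (1 / 4) (C / 4) (by norm_num) fun n ↦ ?_).tendsto_limUnder
  have hsub : h ((2 ^ n : ℕ) • x) / 4 ^ n - h ((2 ^ (n + 1) : ℕ) • x) / 4 ^ (n + 1) =
      -(h ((2 ^ (n + 1) : ℕ) • x) - 4 * h ((2 ^ n : ℕ) • x)) / 4 ^ (n + 1) := by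
    field_simp
    ring
  rw [Real.dist_eq, hsub, abs_div, abs_neg, abs_of_pos (by positivity : (0 : ℝ) < 4 ^ (n + 1)),
    div_pow, one_pow, div_mul_div_comm, mul_one, ← pow_succ']
  gcongr
  exact hC n

theorem tateLimit_parallelogram (x y : A) :
    tateLimit h (x + y) + tateLimit h (x - y) = 2 * (tateLimit h x + tateLimit h y) := by
  obtain ⟨S, hx, hy, C, hC⟩ := hh x y
  have hlim := ((hh.tendsto_tateLimit (x + y)).add (hh.tendsto_tateLimit (x - y))).sub
    (((hh.tendsto_tateLimit x).add (hh.tendsto_tateLimit y)).const_mul 2)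
  have herror : Tendsto (fun n : ℕ ↦ C / (4 : ℝ) ^ n) atTop (𝓝 0) :=
    tendsto_const_nhds.div_atTop (tendsto_pow_atTop_atTop_of_one_lt (by norm_num))
  refine sub_eq_zero.mp (tendsto_nhds_unique hlim (squeeze_zero_norm (fun n ↦ ?_) herror))
  rw [Real.norm_eq_abs, ← add_div, ← add_div, mul_div_assoc', ← sub_div, abs_div,
    abs_of_pos (by positivity : (0 : ℝ) < 4 ^ n), nsmul_add, nsmul_sub]
  gcongr
  exact hC _ (S.nsmul_mem hx _) _ (S.nsmul_mem hy _)

theorem isHomogeneousHeight_tateLimit (hnonneg : ∀ x, 0 ≤ h x) :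
    IsHomogeneousHeight (tateLimit h) 2 :=
  isHomogeneousHeight_of_parallelogram
    (fun x ↦ ge_of_tendsto' (hh.tendsto_tateLimit x) fun _ ↦ div_nonneg (hnonneg _) (by positivity))
    hh.tateLimit_parallelogram

end LocallyApproxParallelogram

end TateLimit

section CanonicalHeights

open NumberField Height WeierstrassCurve.Affine

theorem isElliptic_of_map {F F' : Type*} [Field F] [Field F'] (W : WeierstrassCurve F)
    (f : F →+* F') [(W.map f).IsElliptic] : W.IsElliptic :=
  ⟨.mk0 _ fun h ↦ (W.map f).isUnit_Δ.ne_zero (by rw [WeierstrassCurve.map_Δ, h, map_zero])⟩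

variable {Ω : Type*} [Field Ω] [CharZero Ω]

theorem naiveHeight_nonneg {W : WeierstrassCurve Ω} (P : W.toAffine.Point) : 0 ≤ naiveHeight P := by
  cases P
  exacts [le_rfl, absLogHeight₁_nonneg _]

theorem isHomogeneousHeight_absLogHeight₁ [Algebra.IsAlgebraic ℚ Ω] :
    IsHomogeneousHeight (fun u : Additive Ωˣ ↦ absLogHeight₁ (u.toMul : Ω)) 1 where
  degree_ne_zero := one_ne_zero
  nonneg _ := absLogHeight₁_nonneg _
  exists_add_le := ⟨1, fun u v ↦ (absLogHeight₁_mul_le _ _).trans_eq (one_mul _).symm⟩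
  apply_zsmul n u := by
    rw [toMul_zsmul, Units.val_zpow_eq_zpow_val, absLogHeight₁_zpow, pow_one]

/-- The finite set of affine coordinates of a point, empty at infinity. A point is defined over
every field that contains these and over which the curve is defined. -/
def pointCoordinates {R : Type*} [CommRing R] [DecidableEq R] {W : WeierstrassCurve R} :
    W.toAffine.Point → Finset R
  | .zero => ∅
  | .some x y _ => {x, y}

theorem exists_numberField_baseChange_eq [Algebra.IsAlgebraic ℚ Ω] (W : WeierstrassCurve Ω)
    (s : Finset Ω) :
    ∃ (L : IntermediateField ℚ Ω) (W₀ : WeierstrassCurve L),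
      NumberField L ∧ (s : Set Ω) ⊆ L ∧ W₀.baseChange Ω = W := by
  classical
  obtain ⟨L, hL, hs⟩ := exists_numberField_subset ({W.a₁, W.a₂, W.a₃, W.a₄, W.a₆} ∪ s)
  rw [Finset.coe_union, Set.union_subset_iff] at hs
  exact ⟨L, ⟨⟨W.a₁, hs.1 (by simp)⟩, ⟨W.a₂, hs.1 (by simp)⟩, ⟨W.a₃, hs.1 (by simp)⟩,
    ⟨W.a₄, hs.1 (by simp)⟩, ⟨W.a₆, hs.1 (by simp)⟩⟩, hL, hs.2, rfl⟩

variable [DecidableEq Ω]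

section Descent

variable {L : IntermediateField ℚ Ω} (W : WeierstrassCurve L)

theorem mem_range_map_of_pointCoordinates_subset {P : (W.baseChange Ω).toAffine.Point}
    (hP : (pointCoordinates P : Set Ω) ⊆ L) :
    P ∈ (Point.map (W' := W) (Algebra.ofId L Ω)).range := by
  rcases P with _ | ⟨x, y, h⟩
  · exact zero_mem _
  · lift x to L using hP (by simp [pointCoordinates])
    lift y to L using hP (by simp [pointCoordinates])
    have hxy := (W.toAffine.baseChange_nonsingular (f := Algebra.ofId L Ω)
      (algebraMap L Ω).injective x y).mp h
    exact ⟨.some x y hxy, rfl⟩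

theorem naiveHeight_map [NumberField L] (P : (W.baseChange L).toAffine.Point) :
    naiveHeight (Point.map (W' := W) (Algebra.ofId L Ω) P) =
      logHeight P.xRep / Module.finrank ℚ L := by
  rcases P with _ | ⟨x, y, h⟩
  · rw [← Point.zero_def, Point.map_zero, Point.xRep_zero]
    simp [naiveHeight]
  · rw [Point.map_some, Point.xRep_some, ← logHeight₁_eq_logHeight]
    exact absLogHeight₁_algebraMap (Ω := Ω) x

end Descent

variable [Algebra.IsAlgebraic ℚ Ω] (W : WeierstrassCurve Ω) [W.IsElliptic]

theorem locallyApproxParallelogram_naiveHeight :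
    LocallyApproxParallelogram (naiveHeight : W.toAffine.Point → ℝ) := by
  intro P Q
  obtain ⟨L, W₀, _, hcoord, rfl⟩ :=
    exists_numberField_baseChange_eq W (pointCoordinates P ∪ pointCoordinates Q)
  rw [Finset.coe_union, Set.union_subset_iff] at hcoord
  refine ⟨_, mem_range_map_of_pointCoordinates_subset W₀ hcoord.1,
    mem_range_map_of_pointCoordinates_subset W₀ hcoord.2, ?_⟩
  have : (W₀.map (algebraMap L Ω)).IsElliptic := ‹(W₀.baseChange Ω).IsElliptic›
  have := isElliptic_of_map W₀ (algebraMap L Ω)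
  have : (W₀.baseChange L).IsElliptic := inferInstanceAs (W₀.map (algebraMap L L)).IsElliptic
  obtain ⟨C, hC⟩ := exists_abs_logHeight_xRep_parallelogram_le (W₀.baseChange L)
  refine ⟨C / Module.finrank ℚ L, ?_⟩
  rintro _ ⟨u, rfl⟩ _ ⟨v, rfl⟩
  rw [← map_add, ← map_sub, naiveHeight_map, naiveHeight_map, naiveHeight_map, naiveHeight_map,
    ← add_div, ← add_div, mul_div_assoc', ← sub_div, abs_div, Nat.abs_cast]
  gcongr
  exact hC u v

theorem isHomogeneousHeight_neronTateHeight :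
    IsHomogeneousHeight (neronTateHeight : W.toAffine.Point → ℝ) 2 :=
  (locallyApproxParallelogram_naiveHeight W).isHomogeneousHeight_tateLimit naiveHeight_nonneg

end CanonicalHeights

section Bogomolov

theorem countable_point {R : Type*} [CommRing R] [Countable R] (W : WeierstrassCurve R) :
    Countable W.toAffine.Point := by
  let coordinates : W.toAffine.Point → Option (R × R)
    | .zero => none
    | .some x y _ => some (x, y)
  have hinj : Function.Injective coordinates := by
    rintro (_ | _) (_ | _) h <;> simp_all [coordinates]
  exact hinj.countable

theorem countable_of_isAlgebraic_rat (Ω : Type*) [Field Ω] [CharZero Ω] [Algebra.IsAlgebraic ℚ Ω] :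
    Countable Ω :=
  Set.countable_univ_iff.mp <| (Algebraic.countable ℚ Ω).mono
    fun x _ ↦ Algebra.IsAlgebraic.isAlgebraic x

variable {K Ω : Type*} [Field K] [Field Ω] [CharZero Ω] [Algebra.IsAlgebraic ℚ Ω] [Algebra K Ω]
  {F : IntermediateField K Ω}

theorem BogomolovGm.free_quotient_torsion (hF : BogomolovGm F) :
    Module.Free ℤ (Additive (Fˣ ⧸ CommGroup.torsion Fˣ)) := by
  obtain ⟨ε, hε, hdisc⟩ := hF
  have := countable_of_isAlgebraic_rat Ω
  have : Countable F := Subtype.countable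
  have : Countable Fˣ := Units.val_injective.countable
  exact (isHomogeneousHeight_absLogHeight₁.comp_addMonoidHom
    (Units.map F.val.toMonoidHom).toAdditive).free_additive_quotient_torsion hε hdisc

theorem BogomolovElliptic.free_quotient_torsion [DecidableEq Ω] {E : WeierstrassCurve K}
    [E.IsElliptic] (hF : BogomolovElliptic E F) :
    Module.Free ℤ ((E.baseChange F).toAffine.Point ⧸
      AddCommGroup.torsion (E.baseChange F).toAffine.Point) := by
  obtain ⟨ε, hε, hdisc⟩ := hF
  have := countable_of_isAlgebraic_rat Ω
  have : Countable F := Subtype.countable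
  have := countable_point (E.baseChange F)
  have : (E.baseChange Ω).IsElliptic := inferInstanceAs (E.map (algebraMap K Ω)).IsElliptic
  exact ((isHomogeneousHeight_neronTateHeight (E.baseChange Ω)).comp_addMonoidHom
    (WeierstrassCurve.Affine.Point.map (W' := E) F.val)).free_quotient_torsion hε hdisc

end Bogomolov

theorem proposition1p1_general {K Ω : Type*} [Field K] [Field Ω] [CharZero Ω]
    [Algebra.IsAlgebraic ℚ Ω] [DecidableEq Ω] [Algebra K Ω] (F : IntermediateField K Ω) :
    (BogomolovGm F → Module.Free ℤ (Additive (Fˣ ⧸ CommGroup.torsion Fˣ))) ∧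
    (∀ E : WeierstrassCurve K, E.IsElliptic → BogomolovElliptic E F →
      Module.Free ℤ ((E.baseChange F).toAffine.Point ⧸
        AddCommGroup.torsion (E.baseChange F).toAffine.Point)) :=
  ⟨BogomolovGm.free_quotient_torsion, fun _ _ ↦ BogomolovElliptic.free_quotient_torsion⟩

theorem proposition1p1 {K Qbar : Type*} [Field K] [NumberField K]
    [Field Qbar] [CharZero Qbar] [IsAlgClosure ℚ Qbar] [DecidableEq Qbar] [Algebra K Qbar]
    (F : IntermediateField K Qbar) :
    (BogomolovGm F → Module.Free ℤ (Additive (Fˣ ⧸ CommGroup.torsion Fˣ))) ∧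
    (∀ E : WeierstrassCurve K, E.IsElliptic → BogomolovElliptic E F →
      Module.Free ℤ ((E.baseChange F).toAffine.Point ⧸
        AddCommGroup.torsion (E.baseChange F).toAffine.Point)) :=
  have : Algebra.IsAlgebraic ℚ Qbar := IsAlgClosure.isAlgebraic
  proposition1p1_general F
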